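/- **Setting.** Fix a vocabulary $\mathcal X=\{e_1,\dots,e_d\}$ (one-hot vectors in $\mathbb R^d$), $n\ge1$ lags $0<r_1<\dots<r_n$, and integers $M>r_n$, $D\ge 0$. Let $\mathcal P$ be a probability distribution on transition kernels $\pi:\mathcal X^n\to\Delta(\mathcal X)$ and $\mu_0$ a distribution on $\mathcal X^{r_n}$. Given $\pi$, the prompt $x_{1:L}$ ($L>M$) is generated by $(x_1,\dots,x_{r_n})\sim\mu_0$ and $x_l\sim\pi(\cdot\mid x_{l-r_1},\dots,x_{l-r_n})$ for $l>r_n$; let $P_\pi$ be the $d^{r_n}\times d^{r_n}$ transition matrix of the chain of blocks of $r_n$ successive tokens. Assume that there are $\lambda<1$ and $\gamma>0$ such that for every $\pi\in\mathrm{supp}(\mathcal P)$ the matrix $P_\pi$ is primitive, all its eigenvalues other than the leading eigenvalue $1$ have modulus at most $\lambda$, and $\pi(x\mid p)\ge\gamma$ for all $x\in\mathcal X$, $p\in\mathcal X^n$. **Information set.** Let $\mu^\pi$ be the law of a window $(z_{l-M},\dots,z_{l-1},z)$ of $M+1$ tokens of the stationary chain, and for $\mathcal S\subseteq[M]$ write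 $Z_{-\mathcal S}=(z_{l-s})_{s\in\mathcal S}$. Let $\mathcal S^\star$ be a maximizer, over the family $[M]_{\le D}$ of subsets of $[M]$ with at most $D$ elements, of $$\tilde I_{\chi^2}(\mathcal S)=\mathbb E_{\pi\sim\mathcal P,\,(z,Z)\sim\mu^\pi}\Big[\Big(\sum_{e\in\mathcal X}\frac{\mu^\pi(z=e\mid Z_{-\mathcal S})^2}{\mu^\pi(z=e)}-1\Big)\,\mu^\pi(Z_{-\mathcal S})\Big].$$ **GIH estimator.** Let $N$ be the number of $l\in\{M+1,\dots,L\}$ such that $x_{l-s}=x_{L+1-s}$ for all $s\in\mathcal S^\star$. Then $y^\star$ is the average of $x_l$ over these $l$ if $N\ge1$, and the average of $x_{M+1},\dots,x_L$ otherwise. **Transformer.** The parameters are $a\in\mathbb R$, $w^{(h)}=(w^{(h)}_{-1},\dots,w^{(h)}_{-M})\in\mathbb R^M$ for the $H=M$ heads $h\in[M]$, and $c_{\mathcal S}\in\mathbb R$ for $\mathcal S\in[M]_{\le D}$. Put $\sigma^{(h)}=\mathrm{softmax}(w^{(h)})$ and $v^{(h)}_l=\sum_{k=1}^M\sigma^{(h)}_{-k}x_{l-k}$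 for $M<l\le L+1$; let $\phi(v)$ be the vector with entries $c_{\mathcal S}\prod_{h\in\mathcal S}v^{(h)}_{i_h}$, for $\mathcal S\in[M]_{\le D}$ and $(i_h)_{h\in\mathcal S}\in[d]^{\mathcal S}$; put $C_D=\sum_{\mathcal S\in[M]_{\le D}}c_{\mathcal S}^2$, $u_l=\phi(v_l)/\sqrt{C_D}$, $p_{\mathcal S}=c_{\mathcal S}^2/C_D$. The output is $$y=\sum_{l=M+1}^L\frac{\exp(a\langle u_{L+1},u_l\rangle)}{\sum_{k=M+1}^L\exp(a\langle u_{L+1},u_k\rangle)}\,x_l .$$ **Training.** The parameters are trained in three stages, ending at times $t_1\le t_2\le t_3$: only the $c_{\mathcal S}$ move in stage I, only the $w^{(h)}$ in stage II, and only $a$ in stage III (by gradient flow or by any other dynamics within the stages). Let $y$ be the output with the parameters at time $t_3$, write $a=a(t_3)$, and put $$\Delta_1=1-p_{\mathcal S^\star}(t_1),\qquad \Delta_2=1-\prod_{h\in\mathcal S^\star}\big(\sigma^{(h)}_{-h}(t_2)\big)^2 .$$ **Lemma (GIH approximation error).** Suppose that $\Delta_1\le K/L$, $\Delta_2\le K/L$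 and $c_1\log L\le a\le c_2\log L$ with constants $K$, $c_1>0$ and $c_2$. Then for every $\pi\in\mathrm{supp}(\mathcal P)$, with probability at least $1-O(L^{-1})$ over the prompt drawn from $\mu_0$ and $\pi$, $$\|y^\star-y\|_1=O\big(L^{-a/\log L}+L^{-1}\log L\big).$$ If moreover $c_2<1$ (for example $a\le(\log L)/8$), then, with probability at least $1-O(L^{-1})$, $$\|y^\star-y\|_1=O\big(L^{-a/\log L}\big).$$ All implied constants depend only on $d$, $(r_1,\dots,r_n)$, $M$, $D$, $\lambda$, $\gamma$, $K$, $c_1$, $c_2$. -/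

import Mathlib

open MeasureTheory

noncomputable section

namespace NGram

/-! ### n-gram Markov chains -/

/-- A parent structure `(-r_1, …, -r_n)` with `0 < r_1 < ⋯ < r_n` (here with `n + 1` parents, so
that there is at least one). -/
structure Parents (n : ℕ) where
  lag : Fin (n + 1) → ℕ
  pos : ∀ i, 0 < lag i
  strictMono : StrictMono lag

/-- The largest lag `r_n`. -/
def Parents.order {n : ℕ} (pa : Parents n) : ℕ := pa.lag (Fin.last n)

theorem Parents.lag_le_order {n : ℕ} (pa : Parents n) (i : Fin (n + 1)) :
    pa.lag i ≤ pa.order :=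
  pa.strictMono.monotone (Fin.le_last i)

theorem Parents.order_pos {n : ℕ} (pa : Parents n) : 0 < pa.order := pa.pos _

/-- Transition kernels `π : 𝒳ⁿ → Δ(𝒳)` over a vocabulary of size `d`; `π p x` is `π(x ∣ p)`. -/
abbrev TransKernel (d n : ℕ) : Type := (Fin (n + 1) → Fin d) → stdSimplex ℝ (Fin d)

/-- Probability of the string `x_1 … x_T` (stored with indices `0, …, T - 1`) when the first `r_n`
tokens have law `ν` and every later token `x_l` is drawn from `π(· ∣ X_{pa(l)})`.
Meaningful for `r_n ≤ T`. -/
def seqProb {d n : ℕ} (pa : Parents n) (π : TransKernel d n) (ν : (Fin pa.order → Fin d) → ℝ)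
    (T : ℕ) (x : Fin T → Fin d) : ℝ :=
  (if h : pa.order ≤ T then ν (fun i => x (Fin.castLE h i)) else 0) *
    ∏ l : Fin T,
      if pa.order ≤ (l : ℕ) then
        (π fun i => x ⟨(l : ℕ) - pa.lag i, (Nat.sub_le _ _).trans_lt l.isLt⟩).1 (x l)
      else 1

open Classical in
/-- Probability of the event `A` about `x_1 … x_T` for the chain of `seqProb`. -/
def seqPr {d n : ℕ} (pa : Parents n) (π : TransKernel d n) (ν : (Fin pa.order → Fin d) → ℝ)
    (T : ℕ) (A : (Fin T → Fin d) → Prop) : ℝ :=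
  ∑ x : Fin T → Fin d, if A x then seqProb pa π ν T x else 0

open Classical in
/-- The matrix `P_π(Z', Z)` of the chain of `r_n`-token states: column `Z` is the last state
`(z_{l-r_n}, …, z_{l-1})`, row `Z'` the current state `(z_{l-r_n+1}, …, z_l)`. -/
def transMatrix {d n : ℕ} (pa : Parents n) (π : TransKernel d n) :
    Matrix (Fin pa.order → Fin d) (Fin pa.order → Fin d) ℝ :=
  fun Z' Z =>
    if ∀ (i : ℕ) (hi : i + 1 < pa.order), Z' ⟨i, by omega⟩ = Z ⟨i + 1, hi⟩ then
      (π fun i => Z ⟨pa.order - pa.lag i, Nat.sub_lt pa.order_pos (pa.pos i)⟩).1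
        (Z' ⟨pa.order - 1, Nat.sub_lt pa.order_pos Nat.one_pos⟩)
    else 0

/-- `|λ₂(P)| ≤ lam`: after removing one copy of the leading eigenvalue `1`, all complex
eigenvalues (with algebraic multiplicity) have modulus at most `lam`. -/
def SecondEigenvalueLE {ι : Type*} [Fintype ι] [DecidableEq ι] (P : Matrix ι ι ℝ) (lam : ℝ) :
    Prop :=
  open Classical in
  ∀ z ∈ ((P.map (algebraMap ℝ ℂ)).charpoly.roots.erase 1), ‖z‖ ≤ lam

/-- The regularity assumption on the mixture `Pm` (a law on transition kernels) of Markov chains, with spectral bound `lam` and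
lower bound `γ` on the transition probabilities. -/
def MarkovAssumption {d n : ℕ} (pa : Parents n) (Pm : Measure (TransKernel d n)) (lam γ : ℝ) :
    Prop :=
  ∀ π ∈ Pm.support,
    (transMatrix pa π).IsPrimitive ∧ SecondEigenvalueLE (transMatrix pa π) lam ∧
      ∀ p x, γ ≤ (π p).1 x

/-! ### Stationary law, modified `χ²`-mutual information, information set -/

/-- `ν` is a stationary distribution of the chain of `r_n`-token states. -/
def IsStationary {d n : ℕ} (pa : Parents n) (π : TransKernel d n)
    (ν : (Fin pa.order → Fin d) → ℝ) : Prop :=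
  ν ∈ stdSimplex ℝ (Fin pa.order → Fin d) ∧ (transMatrix pa π).mulVec ν = ν

open Classical in
/-- The stationary distribution of the chain with kernel `π` (it exists and is unique when
`transMatrix pa π` is primitive). -/
def stationary {d n : ℕ} (pa : Parents n) (π : TransKernel d n) :
    (Fin pa.order → Fin d) → ℝ :=
  if h : ∃ ν, IsStationary pa π ν then h.choose else 0

/-- The probability under `μ^π`, the stationary law of a window `(z_{l-M}, …, z_l)` of `M + 1`
tokens, of the event `A`. The entry of index `M - s` of a window is `z_{l-s}`. -/
def statPr {d n : ℕ} (pa : Parents n) (M : ℕ) (π : TransKernel d n)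
    (A : (Fin (M + 1) → Fin d) → Prop) : ℝ :=
  seqPr pa π (stationary pa π) (M + 1) A

/-- The token `z_{l-s}` of the window `w = (z_{l-M}, …, z_l)`. -/
def winTok {d M : ℕ} (w : Fin (M + 1) → Fin d) (s : ℕ) : Fin d := w ⟨M - s, by omega⟩

/-- The integrand of the modified `χ²`-mutual information at the kernel `π`. -/
def modChiSqAt {d n : ℕ} (pa : Parents n) (M : ℕ) (S : Finset ℕ) (π : TransKernel d n) : ℝ :=
  ∑ w : Fin (M + 1) → Fin d, seqProb pa π (stationary pa π) (M + 1) w *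
    ((∑ e : Fin d,
        (statPr pa M π (fun w' => winTok w' 0 = e ∧ ∀ s ∈ S, winTok w' s = winTok w s) /
          statPr pa M π (fun w' => ∀ s ∈ S, winTok w' s = winTok w s)) ^ 2 /
        statPr pa M π (fun w' => winTok w' 0 = e)) - 1) *
    statPr pa M π (fun w' => ∀ s ∈ S, winTok w' s = winTok w s)

/-- The modified `χ²`-mutual information `Ĩ_{χ²}(S)`. -/
def modChiSq {d n : ℕ} (pa : Parents n) (M : ℕ) (Pm : Measure (TransKernel d n))
    (S : Finset ℕ) : ℝ :=
  ∫ π, modChiSqAt pa M S π ∂Pm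

/-- `[H]_{≤ D}`: the subsets of `{1, …, H}` with at most `D` elements. -/
def lowDeg (H D : ℕ) : Finset (Finset ℕ) :=
  (Finset.Icc 1 H).powerset.filter fun S => S.card ≤ D

/-- `S` is an information set: a maximizer of `Ĩ_{χ²}` over `[M]_{≤ D}`. -/
def IsInfoSet {d n : ℕ} (pa : Parents n) (M D : ℕ) (Pm : Measure (TransKernel d n))
    (S : Finset ℕ) : Prop :=
  S ∈ lowDeg M D ∧ ∀ T ∈ lowDeg M D, modChiSq pa M Pm T ≤ modChiSq pa M Pm S

/-! ### One-hot embedding and the generalized induction head -/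

/-- The rows of the input `X̃ = (x_1, …, x_L, 0)`, indexed from `1`: row `l ∈ {1, …, L}` is the
one-hot vector of `x_l`, and all other rows are zero. -/
def embed {d L : ℕ} (x : Fin L → Fin d) (l : ℕ) : Fin d → ℝ :=
  if h : 1 ≤ l ∧ l ≤ L then Pi.single (x ⟨l - 1, by omega⟩) 1 else 0

open Classical in
/-- The positions `l ∈ {M+1, …, L}` with `X_{l-S} = X_{L+1-S}`. -/
def matchSet {d L : ℕ} (M : ℕ) (S : Finset ℕ) (x : Fin L → Fin d) : Finset ℕ :=
  (Finset.Icc (M + 1) L).filter fun l => ∀ s ∈ S, embed x (l - s) = embed x (L + 1 - s)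

/-- The output `y*` of the generalized induction head with window `M` and information set `S`. -/
def gih {d L : ℕ} (M : ℕ) (S : Finset ℕ) (x : Fin L → Fin d) : Fin d → ℝ :=
  if 1 ≤ (matchSet M S x).card then
    ((matchSet M S x).card : ℝ)⁻¹ • ∑ l ∈ matchSet M S x, embed x l
  else ((L : ℝ) - M)⁻¹ • ∑ l ∈ Finset.Icc (M + 1) L, embed x l

/-! ### The two-attention-layer transformer `TF(M, H, d, D)` -/

/-- Trainable parameters: `w h k` is `w^{(h)}_{-k}` for `h ∈ {1, …, H}`, `k ∈ {1, …, M}`, and `c S`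
is `c_S` for `S ∈ [H]_{≤ D}` (other values are never used). -/
structure Params where
  a : ℝ
  w : ℕ → ℕ → ℝ
  c : Finset ℕ → ℝ

/-- `exp (W_P(l, j))` for the relative positional embedding `v`, with `exp (-∞) = 0`. -/
def rpeExp (M : ℕ) (v : ℕ → ℝ) (l j : ℕ) : ℝ :=
  if j < l ∧ l - j ≤ M then Real.exp (v (l - j)) else 0

/-- Output `v_l` of one head of the first attention layer, with positional embedding `v`. -/
def headOut {d L : ℕ} (M : ℕ) (v : ℕ → ℝ) (x : Fin L → Fin d) (l : ℕ) : Fin d → ℝ :=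
  ∑ j ∈ Finset.Icc 1 L,
    (rpeExp M v l j / ∑ k ∈ Finset.Icc 1 L, rpeExp M v l k) • embed x j

/-- The coordinates of the FFN features: a set `S ∈ [H]_{≤ D}` and indices `i_h`, `h ∈ S`. -/
abbrev FeatIdx (d H D : ℕ) : Type := (S : lowDeg H D) × (S.1 → Fin d)

/-- The FFN `φ`: its coordinate at `(S, i)` is `c_S ∏_{h ∈ S} v^{(h)}_{i_h}`. -/
def ffn {d : ℕ} (H D : ℕ) (c : Finset ℕ → ℝ) (v : ℕ → Fin d → ℝ) : FeatIdx d H D → ℝ :=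
  fun q => c q.1.1 * ∏ h : q.1.1, v h (q.2 h)

/-- `φ` has the low-degree polynomial kernel. -/
theorem ffn_dotProduct {d : ℕ} (H D : ℕ) (c : Finset ℕ → ℝ) (v v' : ℕ → Fin d → ℝ) :
    ffn H D c v ⬝ᵥ ffn H D c v' =
      ∑ S ∈ lowDeg H D, c S ^ 2 * ∏ h ∈ S, (v h ⬝ᵥ v' h) := by
  rw [← Finset.sum_coe_sort (lowDeg H D)]
  simp only [dotProduct, ffn]
  rw [Fintype.sum_sigma]
  refine Finset.sum_congr rfl fun S _ => ?_
  rw [← Finset.prod_coe_sort S.1, Fintype.prod_sum, Finset.mul_sum]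
  refine Finset.sum_congr rfl fun i _ => ?_
  rw [Finset.prod_mul_distrib]
  ring

/-- `C_D = ∑_{S ∈ [H]_{≤ D}} c_S²`. -/
def normC (H D : ℕ) (c : Finset ℕ → ℝ) : ℝ := ∑ S ∈ lowDeg H D, c S ^ 2

/-- The normalized feature `u_l = φ(v_l) / √C_D`. -/
def feat {d L : ℕ} (M H D : ℕ) (θ : Params) (x : Fin L → Fin d) (l : ℕ) : FeatIdx d H D → ℝ :=
  (Real.sqrt (normC H D θ.c))⁻¹ • ffn H D θ.c (fun h => headOut M (θ.w h) x l)

/-- The output `y` of the transformer `TF(M, H, d, D)` with parameters `θ` on the prompt `x`. -/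
def tf {d L : ℕ} (M H D : ℕ) (θ : Params) (x : Fin L → Fin d) : Fin d → ℝ :=
  ∑ j ∈ Finset.Icc (M + 1) L,
    (Real.exp (θ.a * (feat M H D θ x (L + 1) ⬝ᵥ feat M H D θ x j)) /
      ∑ k ∈ Finset.Icc (M + 1) L,
        Real.exp (θ.a * (feat M H D θ x (L + 1) ⬝ᵥ feat M H D θ x k))) • embed x j

/-! ### Three-stage training -/

/-- The three-stage schedule on `[0, t₁]`, `[t₁, t₂]`, `[t₂, t₃]`: only the `c_S` move in the first
stage, only the `w^{(h)}` in the second, only `a` in the third. The dynamics inside a stage is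
arbitrary, gradient flow on the cross-entropy loss being one instance. -/
structure IsThreeStage (Θ : ℝ → Params) (t₁ t₂ t₃ : ℝ) : Prop where
  t₁_nonneg : 0 ≤ t₁
  t₁_le : t₁ ≤ t₂
  t₂_le : t₂ ≤ t₃
  stage1 : ∀ t ∈ Set.Icc 0 t₁, (Θ t).w = (Θ 0).w ∧ (Θ t).a = (Θ 0).a
  stage2 : ∀ t ∈ Set.Icc t₁ t₂, (Θ t).c = (Θ t₁).c ∧ (Θ t).a = (Θ t₁).a
  stage3 : ∀ t ∈ Set.Icc t₂ t₃, (Θ t).c = (Θ t₂).c ∧ (Θ t).w = (Θ t₂).w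

/-- `p_S = c_S² / C_D`. -/
def pRatio (H D : ℕ) (θ : Params) (S : Finset ℕ) : ℝ := θ.c S ^ 2 / normC H D θ.c

/-- `σ^{(h)}_{-k}`, the softmax of `w^{(h)} ∈ ℝ^M` at the entry `-k`. -/
def attnProb (M : ℕ) (θ : Params) (h k : ℕ) : ℝ :=
  Real.exp (θ.w h k) / ∑ j ∈ Finset.Icc 1 M, Real.exp (θ.w h j)

/-- `Δ₁ = 1 - p_S`. -/
def delta1 (H D : ℕ) (S : Finset ℕ) (θ : Params) : ℝ := 1 - pRatio H D θ S

/-- `Δ₂ = 1 - ∏_{h ∈ S} (σ^{(h)}_{-h})²`. -/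
def delta2 (M : ℕ) (S : Finset ℕ) (θ : Params) : ℝ := 1 - ∏ h ∈ S, attnProb M θ h h ^ 2

/-- The `ℓ¹` norm on `ℝ^d`. -/
def l1norm {d : ℕ} (v : Fin d → ℝ) : ℝ := ∑ k, |v k|

end NGram

end

/-!
The score of a position `l` is `∑_S p_S ∏_{h ∈ S} ⟨v^{(h)}_{L+1}, v^{(h)}_l⟩`. When `p_{S⋆}` and the
`σ^{(h)}_{-h}`, `h ∈ S⋆`, are within `O(1/L)` of `1`, it is `1 - O(1/L)` at the positions that match
the end of the prompt on `S⋆` and `O(1/L)` at all others. After multiplication by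
`a = O(log L)` and exponentiation, the weights of the matches agree up to a factor
`1 + O(log L / L)`, and each other position weighs `O(e^{-a})` times as much as a match. If a
positive fraction of the positions are matches, the output is thus within `O(e^{-a} + log L / L)` of
their average `y⋆`; here `e^{-a} = L^{-a / log L}`, and it dominates `log L / L` if `a ≤ c log L`
with `c < 1`.

Matches are frequent: each of the disjoint blocks of `M` consecutive tokens spells a prescribed
pattern with conditional probability at least `γ^M` given the past, so by Chernoff's bound fewer
than `γ^M B / 4` of the first `B` blocks spell it with probability exponentially small in `B`. The
pattern that has to be matched is itself random, hence a union bound over all `d^M` patterns.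
-/

namespace NGram

open Finset
open Real (exp exp_pos exp_add one_le_exp one_sub_le_exp_neg exp_neg_one_lt_half)

/-! ### Occurrences of patterns along the chain -/

section Blocks

variable {d : ℕ}

/-- The cylinder of sequences that spell the pattern `q` from position `T` on. -/
def blockAt {m : ℕ} (q : Fin m → Fin d) (T : ℕ) : Set (ℕ → Fin d) :=
  {z | ∀ j : Fin m, z (T + j) = q j}

theorem dependsOn_mem_blockAt {m : ℕ} (q : Fin m → Fin d) (T : ℕ) :
    DependsOn (· ∈ blockAt q T) (Set.Iio (T + m)) := fun _ _ h =>
  propext (forall_congr' fun j => by rw [h _ (Nat.add_lt_add_left j.2 T)])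

theorem dependsOn_indicator_blockAt {m T : ℕ} {F : (ℕ → Fin d) → ℝ}
    (hF : DependsOn F (Set.Iio T)) (q : Fin m → Fin d) :
    DependsOn ((blockAt q T).indicator F) (Set.Iio (T + m)) := by
  classical
  intro z z' h
  have hmem : (z ∈ blockAt q T) = (z' ∈ blockAt q T) := dependsOn_mem_blockAt q T h
  simp only [Set.indicator_apply, hmem,
    hF.mono (Set.Iio_subset_Iio (Nat.le_add_right T m)) h]

theorem blockAt_succ {m : ℕ} (q : Fin (m + 1) → Fin d) (T : ℕ) :
    blockAt q T = {z | z (T + m) = q (Fin.last m)} ∩ blockAt (Fin.init q) T := by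
  ext z
  simp only [blockAt, Fin.init, Set.mem_inter_iff, Set.mem_ofPred_eq, Fin.forall_fin_succ',
    Fin.val_castSucc, Fin.val_last, and_comm]

open Classical in
/-- The number of occurrences of the pattern `q` among the `B` consecutive disjoint blocks that
follow position `r`. -/
noncomputable def blockCount {m : ℕ} (r B : ℕ) (q : Fin m → Fin d) (z : ℕ → Fin d) : ℕ :=
  #{k ∈ range B | z ∈ blockAt q (r + k * m)}

theorem dependsOn_blockCount {m : ℕ} (r B : ℕ) (q : Fin m → Fin d) :
    DependsOn (blockCount r B q) (Set.Iio (r + B * m)) := by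
  classical
  intro z z' h
  refine congrArg card (filter_congr fun k hk => ?_)
  have hkB : r + k * m + m ≤ r + B * m := by
    have := Nat.mul_le_mul_right m (mem_range.1 hk)
    rw [Nat.succ_mul] at this
    omega
  exact iff_of_eq ((dependsOn_mem_blockAt q _).mono (Set.Iio_subset_Iio hkB) h)

theorem exp_neg_blockCount_succ {m : ℕ} (r B : ℕ) (q : Fin m → Fin d) :
    (fun z => exp (-(blockCount r (B + 1) q z : ℝ))) =
      (fun z => exp (-(blockCount r B q z : ℝ))) - (1 - exp (-1)) •
        (blockAt q (r + B * m)).indicator fun z => exp (-(blockCount r B q z : ℝ)) := by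
  classical
  funext z
  by_cases hz : z ∈ blockAt q (r + B * m)
  · have hcount : blockCount r (B + 1) q z = blockCount r B q z + 1 := by
      simp [blockCount, range_add_one, filter_insert, hz]
    simp only [Pi.sub_apply, Pi.smul_apply, Set.indicator_of_mem hz, hcount, smul_eq_mul,
      Nat.cast_add_one, neg_add, exp_add]
    ring
  · have hcount : blockCount r (B + 1) q z = blockCount r B q z := by
      simp [blockCount, range_add_one, filter_insert, hz]
    simp [hcount, hz]

end Blocks

section Chain

variable {d n : ℕ} {pa : Parents n} {π : TransKernel d n} {ν : (Fin pa.order → Fin d) → ℝ}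

theorem seqProb_nonneg (hν : ∀ z, 0 ≤ ν z) {T : ℕ} (x : Fin T → Fin d) :
    0 ≤ seqProb pa π ν T x := by
  unfold seqProb
  refine mul_nonneg ?_ (prod_nonneg fun l _ => ?_) <;> split_ifs
  exacts [hν _, le_rfl, (π _).2.1 _, zero_le_one]

theorem seqPr_nonneg (hν : ∀ z, 0 ≤ ν z) {T : ℕ} (A : (Fin T → Fin d) → Prop) :
    0 ≤ seqPr pa π ν T A := by
  refine sum_nonneg fun x _ => ?_
  split_ifs
  exacts [seqProb_nonneg hν x, le_rfl]

theorem seqPr_mono (hν : ∀ z, 0 ≤ ν z) {T : ℕ} {A A' : (Fin T → Fin d) → Prop}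
    (h : ∀ x, A x → A' x) : seqPr pa π ν T A ≤ seqPr pa π ν T A' := by
  refine sum_le_sum fun x _ => ?_
  split_ifs with hA hA'
  exacts [le_rfl, absurd (h x hA) hA', seqProb_nonneg hν x, le_rfl]

theorem neZero_of_mem_stdSimplex (hν : ν ∈ stdSimplex ℝ (Fin pa.order → Fin d)) : NeZero d := by
  obtain ⟨z, -⟩ := exists_ne_zero_of_sum_ne_zero (hν.2.trans_ne one_ne_zero)
  exact ⟨(Fin.pos (z ⟨0, pa.order_pos⟩)).ne'⟩

variable [NeZero d]

/-- The string `x` continued by a default token to a sequence on `ℕ`, so that strings of different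
lengths can be compared. -/
def extendTok {T : ℕ} (x : Fin T → Fin d) (l : ℕ) : Fin d :=
  if h : l < T then x ⟨l, h⟩ else 0

theorem extendTok_of_lt {T : ℕ} (x : Fin T → Fin d) {l : ℕ} (h : l < T) :
    extendTok x l = x ⟨l, h⟩ := dif_pos h

theorem extendTok_snoc_of_lt {T : ℕ} (x : Fin T → Fin d) (e : Fin d) {l : ℕ} (h : l < T) :
    extendTok (Fin.snoc (α := fun _ => Fin d) x e) l = extendTok x l := by
  simp [extendTok, h, h.trans T.lt_succ_self, Fin.snoc]

theorem extendTok_snoc_self {T : ℕ} (x : Fin T → Fin d) (e : Fin d) :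
    extendTok (Fin.snoc (α := fun _ => Fin d) x e) T = e := by
  simp [extendTok, Fin.snoc]

theorem seqProb_snoc {T : ℕ} (hT : pa.order ≤ T) (x : Fin T → Fin d) (e : Fin d) :
    seqProb pa π ν (T + 1) (Fin.snoc (α := fun _ => Fin d) x e) =
      seqProb pa π ν T x * (π fun i => extendTok x (T - pa.lag i)).1 e := by
  have hcast (i : Fin pa.order) : (i : ℕ) < T := i.2.trans_le hT
  have hlag (l : Fin T) (i) : (l : ℕ) - pa.lag i < T := (Nat.sub_le _ _).trans_lt l.2
  have hlast (i) : T - pa.lag i < T := Nat.sub_lt (pa.order_pos.trans_le hT) (pa.pos i)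
  unfold seqProb
  rw [dif_pos hT, dif_pos (hT.trans T.le_succ), Fin.prod_univ_castSucc, ← mul_assoc]
  congr 1
  · congr 1
    · congr 1
      funext i
      simp only [Fin.snoc, Fin.val_castLE, hcast i, dite_true]
      rfl
    · exact prod_congr rfl fun l _ => by simp [Fin.snoc, hlag l]
  · simp [Fin.snoc, hlast, hT, extendTok]

variable (pa π ν) in
/-- The expectation of `F` under the law `seqProb` of strings of length `T`. -/
noncomputable def seqExp (T : ℕ) : ((ℕ → Fin d) → ℝ) →ₗ[ℝ] ℝ :=
  ∑ x : Fin T → Fin d, seqProb pa π ν T x • LinearMap.proj (extendTok x)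

theorem seqExp_apply (T : ℕ) (F : (ℕ → Fin d) → ℝ) :
    seqExp pa π ν T F = ∑ x, seqProb pa π ν T x * F (extendTok x) := by
  simp [seqExp]

theorem seqExp_nonneg (hν : ∀ z, 0 ≤ ν z) (T : ℕ) {F : (ℕ → Fin d) → ℝ} (hF : ∀ z, 0 ≤ F z) :
    0 ≤ seqExp pa π ν T F := by
  rw [seqExp_apply]
  exact sum_nonneg fun x _ => mul_nonneg (seqProb_nonneg hν x) (hF _)

theorem seqExp_succ {T : ℕ} (hT : pa.order ≤ T) (F : (ℕ → Fin d) → ℝ) :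
    seqExp pa π ν (T + 1) F = ∑ x : Fin T → Fin d, seqProb pa π ν T x *
      ∑ e, (π fun i => extendTok x (T - pa.lag i)).1 e *
        F (extendTok (Fin.snoc (α := fun _ => Fin d) x e)) := by
  rw [seqExp_apply, ← (Fin.snocEquiv fun _ : Fin (T + 1) => Fin d).sum_comp,
    Fintype.sum_prod_type_right]
  refine sum_congr rfl fun x _ => ?_
  rw [mul_sum]
  refine sum_congr rfl fun e _ => ?_
  rw [← mul_assoc, ← seqProb_snoc hT]
  rfl

theorem dependsOn_extendTok_snoc {T : ℕ} {F : (ℕ → Fin d) → ℝ} (hF : DependsOn F (Set.Iio T))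
    (x : Fin T → Fin d) (e : Fin d) :
    F (extendTok (Fin.snoc (α := fun _ => Fin d) x e)) = F (extendTok x) :=
  hF fun _ hi => extendTok_snoc_of_lt x e hi

theorem seqExp_eq_of_dependsOn {T T' : ℕ} (hT : pa.order ≤ T) (hTT' : T ≤ T')
    {F : (ℕ → Fin d) → ℝ} (hF : DependsOn F (Set.Iio T)) :
    seqExp pa π ν T' F = seqExp pa π ν T F := by
  induction T', hTT' using Nat.le_induction with
  | base => rfl
  | succ k hk ih =>
    have hFk : DependsOn F (Set.Iio k) := hF.mono (Set.Iio_subset_Iio hk)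
    rw [← ih, seqExp_succ (hT.trans hk), seqExp_apply]
    simp only [dependsOn_extendTok_snoc hFk, ← sum_mul, (π _).2.2, one_mul]

theorem seqExp_one (hν : ∑ z, ν z = 1) {T : ℕ} (hT : pa.order ≤ T) :
    seqExp pa π ν T 1 = 1 := by
  rw [seqExp_eq_of_dependsOn le_rfl hT fun _ _ _ => rfl, seqExp_apply, ← hν]
  refine sum_congr rfl fun x _ => ?_
  have hprod : ∀ l : Fin pa.order, ¬ pa.order ≤ (l : ℕ) := fun l => not_le.2 l.2
  simp only [seqProb, le_refl, dite_true, hprod, if_false, prod_const_one, Pi.one_apply, mul_one]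
  rfl

theorem one_sub_seqExp_le_seqPr (hν : ν ∈ stdSimplex ℝ (Fin pa.order → Fin d)) {T : ℕ}
    (hT : pa.order ≤ T) {A : (Fin T → Fin d) → Prop} {G : (ℕ → Fin d) → ℝ} (hG : ∀ z, 0 ≤ G z)
    (hA : ∀ x, ¬ A x → 1 ≤ G (extendTok x)) :
    1 - seqExp pa π ν T G ≤ seqPr pa π ν T A := by
  rw [← seqExp_one (π := π) hν.2 hT, ← map_sub, seqExp_apply]
  refine sum_le_sum fun x _ => ?_
  have hx : 0 ≤ seqProb pa π ν T x := seqProb_nonneg hν.1 x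
  split_ifs with h
  · exact mul_le_of_le_one_right hx (sub_le_self 1 (hG _))
  · exact mul_nonpos_of_nonneg_of_nonpos hx (sub_nonpos.2 (hA x h))

theorem mul_seqExp_le_seqExp_succ_indicator (hν : ∀ z, 0 ≤ ν z) {γ : ℝ}
    (hπ : ∀ p x, γ ≤ (π p).1 x) {T : ℕ} (hT : pa.order ≤ T) {F : (ℕ → Fin d) → ℝ}
    (hF : DependsOn F (Set.Iio T)) (hF0 : ∀ z, 0 ≤ F z) (e : Fin d) :
    γ * seqExp pa π ν T F ≤ seqExp pa π ν (T + 1) ({z | z T = e}.indicator F) := by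
  classical
  rw [seqExp_succ hT, seqExp_apply, mul_sum]
  refine sum_le_sum fun x _ => ?_
  simp only [Set.indicator_apply, Set.mem_ofPred_eq, extendTok_snoc_self,
    dependsOn_extendTok_snoc hF, mul_ite, mul_zero, sum_ite_eq', mem_univ, if_true]
  rw [mul_left_comm]
  exact mul_le_mul_of_nonneg_left (mul_le_mul_of_nonneg_right (hπ _ _) (hF0 _))
    (seqProb_nonneg hν x)

theorem pow_mul_seqExp_le_seqExp_indicator_blockAt (hν : ∀ z, 0 ≤ ν z) {γ : ℝ} (hγ : 0 ≤ γ)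
    (hπ : ∀ p x, γ ≤ (π p).1 x) {T : ℕ} (hT : pa.order ≤ T) {F : (ℕ → Fin d) → ℝ}
    (hF : DependsOn F (Set.Iio T)) (hF0 : ∀ z, 0 ≤ F z) {m : ℕ} (q : Fin m → Fin d) :
    γ ^ m * seqExp pa π ν T F ≤ seqExp pa π ν (T + m) ((blockAt q T).indicator F) := by
  induction m with
  | zero => simp [blockAt]
  | succ m ih =>
    rw [blockAt_succ, ← Set.indicator_indicator, pow_succ', mul_assoc]
    exact (mul_le_mul_of_nonneg_left (ih (Fin.init q)) hγ).trans
      (mul_seqExp_le_seqExp_succ_indicator hν hπ (hT.trans (Nat.le_add_right T m))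
        (dependsOn_indicator_blockAt hF _) (fun z => Set.indicator_nonneg (fun z _ => hF0 z) z) _)

theorem seqExp_exp_neg_blockCount_le (hν : ν ∈ stdSimplex ℝ (Fin pa.order → Fin d)) {γ : ℝ}
    (hγ : 0 ≤ γ) (hπ : ∀ p x, γ ≤ (π p).1 x) {m : ℕ} (q : Fin m → Fin d) (B : ℕ) :
    seqExp pa π ν (pa.order + B * m) (fun z => exp (-(blockCount pa.order B q z : ℝ))) ≤
      exp (-(γ ^ m * B / 2)) := by
  induction B with
  | zero =>
    have hone : (fun z => exp (-(blockCount pa.order 0 q z : ℝ))) = 1 := by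
      funext z; simp [blockCount]
    simp [hone, seqExp_one hν.2]
  | succ B ih =>
    set T := pa.order + B * m
    set F : (ℕ → Fin d) → ℝ := fun z => exp (-(blockCount pa.order B q z : ℝ))
    have hF : DependsOn F (Set.Iio T) := fun z z' h => by
      simp only [F, dependsOn_blockCount pa.order B q h]
    have hF0 : ∀ z, 0 ≤ F z := fun z => (exp_pos _).le
    have hT : pa.order ≤ T := Nat.le_add_right _ _
    have hblock := pow_mul_seqExp_le_seqExp_indicator_blockAt hν.1 hγ hπ hT hF hF0 q
    have hind := (mul_nonneg (pow_nonneg hγ m) (seqExp_nonneg (π := π) hν.1 T hF0)).trans hblock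
    rw [exp_neg_blockCount_succ, show pa.order + (B + 1) * m = T + m by simp only [T]; ring,
      map_sub, map_smul, seqExp_eq_of_dependsOn hT (Nat.le_add_right T m) hF, smul_eq_mul]
    calc seqExp pa π ν T F - (1 - exp (-1)) *
          seqExp pa π ν (T + m) ((blockAt q T).indicator F)
        ≤ seqExp pa π ν T F - 1 / 2 * (γ ^ m * seqExp pa π ν T F) := by
          nlinarith [exp_neg_one_lt_half]
      _ = (1 - γ ^ m / 2) * seqExp pa π ν T F := by ring
      _ ≤ exp (-(γ ^ m / 2)) * exp (-(γ ^ m * B / 2)) :=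
          mul_le_mul (one_sub_le_exp_neg _) ih (seqExp_nonneg hν.1 T hF0) (exp_pos _).le
      _ = exp (-(γ ^ m * (B + 1 : ℕ) / 2)) := by
          rw [← exp_add]; push_cast; congr 1; ring

/-- Chernoff's bound for each pattern, and a union bound over the patterns. -/
theorem one_sub_le_seqPr_forall_le_blockCount (hν : ν ∈ stdSimplex ℝ (Fin pa.order → Fin d))
    {γ : ℝ} (hγ : 0 ≤ γ) (hπ : ∀ p x, γ ≤ (π p).1 x) {m B L : ℕ} (hL : pa.order + B * m ≤ L) :
    1 - (d : ℝ) ^ m * exp (-(γ ^ m * B / 4)) ≤ seqPr pa π ν L fun x =>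
      ∀ q : Fin m → Fin d, γ ^ m * B / 4 ≤ blockCount pa.order B q (extendTok x) := by
  set b := γ ^ m * B / 4
  set G : (Fin m → Fin d) → (ℕ → Fin d) → ℝ := fun q z => exp (-(blockCount pa.order B q z : ℝ))
  have hG (q) : seqExp pa π ν L (G q) ≤ exp (-(2 * b)) := by
    have hdep : DependsOn (G q) (Set.Iio (pa.order + B * m)) := fun z z' h => by
      simp only [G, dependsOn_blockCount pa.order B q h]
    rw [seqExp_eq_of_dependsOn (Nat.le_add_right _ _) hL hdep]
    convert seqExp_exp_neg_blockCount_le hν hγ hπ q B using 3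
    ring
  have hsum : seqExp pa π ν L (exp b • ∑ q, G q) ≤ (d : ℝ) ^ m * exp (-b) := by
    calc seqExp pa π ν L (exp b • ∑ q, G q) = exp b * ∑ q, seqExp pa π ν L (G q) := by
          rw [map_smul, map_sum, smul_eq_mul]
      _ ≤ exp b * ∑ _q : Fin m → Fin d, exp (-(2 * b)) := by gcongr with q; exact hG q
      _ = (d : ℝ) ^ m * (exp b * exp (-(2 * b))) := by simp; ring
      _ = (d : ℝ) ^ m * exp (-b) := by rw [← exp_add]; congr 2; ring
  refine (sub_le_sub_left hsum 1).trans (one_sub_seqExp_le_seqPr hν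
    ((Nat.le_add_right _ _).trans hL) (fun z => ?_) fun x hx => ?_)
  · simp only [Pi.smul_apply, Finset.sum_apply, smul_eq_mul]
    positivity
  · push Not at hx
    obtain ⟨q, hq⟩ := hx
    simp only [Pi.smul_apply, Finset.sum_apply, smul_eq_mul]
    calc (1 : ℝ) ≤ exp b * G q (extendTok x) := by
          rw [← exp_add]; exact one_le_exp (by linarith)
      _ ≤ exp b * ∑ q, G q (extendTok x) := by
          gcongr
          exact single_le_sum (f := fun q => G q (extendTok x)) (fun q _ => (exp_pos _).le)
            (mem_univ q)

end Chain

/-! ### Attention scores -/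

section Embed

variable {d L : ℕ} (x : Fin L → Fin d)

theorem embed_eq_single {l : ℕ} (h : 1 ≤ l ∧ l ≤ L) :
    embed x l = Pi.single (x ⟨l - 1, by omega⟩) 1 := dif_pos h

theorem embed_nonneg (l : ℕ) : 0 ≤ embed x l := by
  unfold embed
  split_ifs
  exacts [Pi.single_nonneg.2 zero_le_one, le_rfl]

theorem embed_dotProduct_self {l : ℕ} (h : 1 ≤ l ∧ l ≤ L) : embed x l ⬝ᵥ embed x l = 1 := by
  simp [embed_eq_single x h]

theorem embed_dotProduct_le_one (l l' : ℕ) : embed x l ⬝ᵥ embed x l' ≤ 1 := by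
  unfold embed
  split_ifs
  · rw [single_one_dotProduct, Pi.single_apply]
    split_ifs
    exacts [le_rfl, zero_le_one]
  all_goals simp

theorem embed_dotProduct_of_ne {l l' : ℕ} (h : embed x l ≠ embed x l') :
    embed x l ⬝ᵥ embed x l' = 0 := by
  unfold embed at h ⊢
  split_ifs at h ⊢
  · rw [single_one_dotProduct, Pi.single_eq_of_ne]
    rintro heq
    exact h (by rw [heq])
  all_goals simp

end Embed

section AttentionProbabilities

variable (M : ℕ) (θ : Params) (h : ℕ)

theorem attnProb_nonneg (k : ℕ) : 0 ≤ attnProb M θ h k :=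
  div_nonneg (exp_pos _).le (sum_nonneg fun _ _ => (exp_pos _).le)

theorem sum_attnProb_le_one : ∑ k ∈ Icc 1 M, attnProb M θ h k ≤ 1 := by
  simp only [attnProb, ← sum_div]
  exact div_self_le_one _

variable {M} in
theorem attnProb_sq_le_one {k : ℕ} (hk : k ∈ Icc 1 M) : attnProb M θ h k ^ 2 ≤ 1 :=
  pow_le_one₀ (attnProb_nonneg M θ h k)
    ((single_le_sum (fun j _ => attnProb_nonneg M θ h j) hk).trans (sum_attnProb_le_one M θ h))

variable {M}

theorem sum_Icc_ite_window {E : Type*} [AddCommMonoid E] {L l : ℕ} (hl : l ∈ Icc (M + 1) (L + 1))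
    (G : ℕ → E) :
    ∑ j ∈ Icc 1 L, (if j < l ∧ l - j ≤ M then G (l - j) else 0) = ∑ k ∈ Icc 1 M, G k := by
  rw [mem_Icc] at hl
  rw [← sum_filter]
  refine sum_nbij' (l - ·) (l - ·) ?_ ?_ ?_ ?_ fun _ _ => rfl <;>
    simp only [mem_filter, mem_Icc] <;> omega

theorem headOut_eq_sum {d L : ℕ} (x : Fin L → Fin d) {l : ℕ} (hl : l ∈ Icc (M + 1) (L + 1)) :
    headOut M (θ.w h) x l = ∑ k ∈ Icc 1 M, attnProb M θ h k • embed x (l - k) := by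
  have hden : ∑ j ∈ Icc 1 L, rpeExp M (θ.w h) l j = ∑ k ∈ Icc 1 M, exp (θ.w h k) :=
    sum_Icc_ite_window hl fun k => exp (θ.w h k)
  rw [headOut, hden]
  refine Eq.trans (sum_congr rfl fun j _ => ?_)
    (sum_Icc_ite_window (L := L) hl fun k => attnProb M θ h k • embed x (l - k))
  rw [rpeExp]
  split_ifs with hj
  · rw [attnProb, Nat.sub_sub_self hj.1.le]
  · rw [zero_div, zero_smul]

end AttentionProbabilities

section WeightedSums

variable {ι : Type*} {I : Finset ι} {σ : ι → ℝ} {B : ι → ι → ℝ}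

theorem sq_mul_le_sum_sum_mul_mul (hσ : ∀ i ∈ I, 0 ≤ σ i)
    (hB : ∀ i ∈ I, ∀ j ∈ I, 0 ≤ B i j) {h : ι} (hh : h ∈ I) :
    σ h ^ 2 * B h h ≤ ∑ i ∈ I, ∑ j ∈ I, σ i * σ j * B i j := by
  have hterm : ∀ i ∈ I, ∀ j ∈ I, 0 ≤ σ i * σ j * B i j := fun i hi j hj =>
    mul_nonneg (mul_nonneg (hσ i hi) (hσ j hj)) (hB i hi j hj)
  calc σ h ^ 2 * B h h = σ h * σ h * B h h := by rw [sq]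
    _ ≤ ∑ j ∈ I, σ h * σ j * B h j := single_le_sum (hterm h hh) hh
    _ ≤ ∑ i ∈ I, ∑ j ∈ I, σ i * σ j * B i j :=
      single_le_sum (f := fun i => ∑ j ∈ I, σ i * σ j * B i j)
        (fun i hi => sum_nonneg (hterm i hi)) hh

theorem sum_sum_mul_le_one (hσ : ∀ i ∈ I, 0 ≤ σ i) (hσ1 : ∑ i ∈ I, σ i ≤ 1) :
    ∑ i ∈ I, ∑ j ∈ I, σ i * σ j ≤ 1 := by
  rw [← sum_mul_sum]
  exact mul_le_one₀ hσ1 (sum_nonneg hσ) hσ1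

theorem sum_sum_mul_mul_le_one_sub (hσ : ∀ i ∈ I, 0 ≤ σ i) (hσ1 : ∑ i ∈ I, σ i ≤ 1)
    (hB : ∀ i ∈ I, ∀ j ∈ I, B i j ≤ 1) {h : ι} (hh : h ∈ I) :
    ∑ i ∈ I, ∑ j ∈ I, σ i * σ j * B i j ≤ 1 - σ h ^ 2 * (1 - B h h) := by
  have hcompl := sq_mul_le_sum_sum_mul_mul (B := fun i j => 1 - B i j) hσ
    (fun i hi j hj => sub_nonneg.2 (hB i hi j hj)) hh
  simp only [mul_sub, mul_one, sum_sub_distrib] at hcompl ⊢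
  linarith [sum_sum_mul_le_one hσ hσ1]

end WeightedSums

section HeadScore

variable {d L : ℕ} (M : ℕ) (θ : Params) (x : Fin L → Fin d)

/-- The inner product of the outputs of the head `h` at the positions `L + 1` and `l`. -/
noncomputable def headScore (h l : ℕ) : ℝ :=
  headOut M (θ.w h) x (L + 1) ⬝ᵥ headOut M (θ.w h) x l

variable {M}

theorem headScore_eq (h : ℕ) {l : ℕ} (hl : l ∈ Icc (M + 1) L) :
    headScore M θ x h l = ∑ i ∈ Icc 1 M, ∑ j ∈ Icc 1 M,
      attnProb M θ h i * attnProb M θ h j * (embed x (L + 1 - i) ⬝ᵥ embed x (l - j)) := by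
  rw [mem_Icc] at hl
  rw [headScore, headOut_eq_sum θ h x (mem_Icc.2 ⟨by omega, le_rfl⟩),
    headOut_eq_sum θ h x (mem_Icc.2 ⟨hl.1, by omega⟩), sum_dotProduct]
  simp only [dotProduct_sum, smul_dotProduct, dotProduct_smul, smul_eq_mul, mul_assoc,
    mul_left_comm]

theorem headScore_nonneg (h : ℕ) {l : ℕ} (hl : l ∈ Icc (M + 1) L) : 0 ≤ headScore M θ x h l := by
  rw [headScore_eq θ x h hl]
  exact sum_nonneg fun i _ => sum_nonneg fun j _ => mul_nonneg
    (mul_nonneg (attnProb_nonneg M θ h i) (attnProb_nonneg M θ h j))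
    (dotProduct_nonneg_of_nonneg (embed_nonneg x _) (embed_nonneg x _))

theorem headScore_le_one (h : ℕ) {l : ℕ} (hl : l ∈ Icc (M + 1) L) : headScore M θ x h l ≤ 1 := by
  rw [headScore_eq θ x h hl]
  refine le_trans (sum_le_sum fun i _ => sum_le_sum fun j _ => ?_)
    (sum_sum_mul_le_one (fun i _ => attnProb_nonneg M θ h i) (sum_attnProb_le_one M θ h))
  exact mul_le_of_le_one_right (mul_nonneg (attnProb_nonneg M θ h i) (attnProb_nonneg M θ h j))
    (embed_dotProduct_le_one x _ _)

variable {h l : ℕ} (hh : h ∈ Icc 1 M) (hl : l ∈ Icc (M + 1) L)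
include hh hl

theorem attnProb_sq_le_headScore (heq : embed x (l - h) = embed x (L + 1 - h)) :
    attnProb M θ h h ^ 2 ≤ headScore M θ x h l := by
  have hrange : 1 ≤ L + 1 - h ∧ L + 1 - h ≤ L := by
    rw [mem_Icc] at hh hl
    omega
  rw [headScore_eq θ x h hl]
  convert sq_mul_le_sum_sum_mul_mul (fun i _ => attnProb_nonneg M θ h i)
    (fun i _ j _ => dotProduct_nonneg_of_nonneg (embed_nonneg x (L + 1 - i))
      (embed_nonneg x (l - j))) hh using 1
  rw [heq, embed_dotProduct_self x hrange, mul_one]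

theorem headScore_le_one_sub_attnProb_sq (hne : embed x (l - h) ≠ embed x (L + 1 - h)) :
    headScore M θ x h l ≤ 1 - attnProb M θ h h ^ 2 := by
  rw [headScore_eq θ x h hl]
  convert sum_sum_mul_mul_le_one_sub (fun i _ => attnProb_nonneg M θ h i)
    (sum_attnProb_le_one M θ h)
    (fun i _ j _ => embed_dotProduct_le_one x (L + 1 - i) (l - j)) hh using 1
  rw [embed_dotProduct_of_ne x hne.symm, sub_zero, mul_one]

end HeadScore

section Score

variable {d L : ℕ} (M H D : ℕ) (θ : Params) (x : Fin L → Fin d)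

/-- The attention score `⟨u_{L+1}, u_l⟩` of the second layer. -/
noncomputable def score (l : ℕ) : ℝ := feat M H D θ x (L + 1) ⬝ᵥ feat M H D θ x l

theorem score_eq_sum (l : ℕ) :
    score M H D θ x l = ∑ S ∈ lowDeg H D, pRatio H D θ S * ∏ h ∈ S, headScore M θ x h l := by
  have hC : 0 ≤ normC H D θ.c := sum_nonneg fun _ _ => sq_nonneg _
  simp only [score, feat, smul_dotProduct, dotProduct_smul, ffn_dotProduct, smul_eq_mul]
  rw [← mul_assoc, ← mul_inv, Real.mul_self_sqrt hC, mul_sum]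
  refine sum_congr rfl fun S _ => ?_
  rw [pRatio, div_eq_inv_mul, mul_assoc]
  rfl

theorem pRatio_nonneg (S : Finset ℕ) : 0 ≤ pRatio H D θ S :=
  div_nonneg (sq_nonneg _) (sum_nonneg fun _ _ => sq_nonneg _)

theorem sum_pRatio_le_one : ∑ S ∈ lowDeg H D, pRatio H D θ S ≤ 1 := by
  simp only [pRatio, ← sum_div]
  exact div_self_le_one _

variable {M H D} {S : Finset ℕ}

theorem delta1_nonneg (hS : S ∈ lowDeg H D) : 0 ≤ delta1 H D S θ :=
  sub_nonneg.2 ((single_le_sum (fun S _ => pRatio_nonneg H D θ S) hS).trans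
    (sum_pRatio_le_one H D θ))

theorem delta2_nonneg (hSM : S ⊆ Icc 1 M) : 0 ≤ delta2 M S θ :=
  sub_nonneg.2 (prod_le_one (fun _ _ => sq_nonneg _) fun h hh =>
    attnProb_sq_le_one θ h (hSM hh))

theorem one_sub_attnProb_sq_le_delta2 (hSM : S ⊆ Icc 1 M) {h : ℕ} (hh : h ∈ S) :
    1 - attnProb M θ h h ^ 2 ≤ delta2 M S θ := by
  rw [delta2, ← mul_prod_erase S _ hh]
  exact sub_le_sub_left (mul_le_of_le_one_right (sq_nonneg _)
    (prod_le_one (fun _ _ => sq_nonneg _) fun k hk =>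
      attnProb_sq_le_one θ k (hSM (mem_of_mem_erase hk)))) 1

theorem prod_headScore_nonneg (S : Finset ℕ) {l : ℕ} (hl : l ∈ Icc (M + 1) L) :
    0 ≤ ∏ h ∈ S, headScore M θ x h l :=
  prod_nonneg fun h _ => headScore_nonneg θ x h hl

theorem prod_headScore_le_one (S : Finset ℕ) {l : ℕ} (hl : l ∈ Icc (M + 1) L) :
    ∏ h ∈ S, headScore M θ x h l ≤ 1 :=
  prod_le_one (fun h _ => headScore_nonneg θ x h hl) fun h _ => headScore_le_one θ x h hl

theorem score_le_one {l : ℕ} (hl : l ∈ Icc (M + 1) L) : score M H D θ x l ≤ 1 := by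
  rw [score_eq_sum]
  exact (sum_le_sum fun S _ => mul_le_of_le_one_right (pRatio_nonneg H D θ S)
    (prod_headScore_le_one θ x S hl)).trans (sum_pRatio_le_one H D θ)

theorem one_sub_delta2_le_prod_headScore (hSM : S ⊆ Icc 1 M) {l : ℕ} (hl : l ∈ matchSet M S x) :
    1 - delta2 M S θ ≤ ∏ h ∈ S, headScore M θ x h l := by
  obtain ⟨hl, hmatch⟩ := mem_filter.1 hl
  rw [delta2, sub_sub_cancel]
  exact prod_le_prod (fun _ _ => sq_nonneg _) fun h hh =>
    attnProb_sq_le_headScore θ x (hSM hh) hl (hmatch h hh)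

theorem prod_headScore_le_delta2 (hSM : S ⊆ Icc 1 M) {l : ℕ} (hl : l ∈ Icc (M + 1) L)
    (hlS : l ∉ matchSet M S x) : ∏ h ∈ S, headScore M θ x h l ≤ delta2 M S θ := by
  obtain ⟨h, hh, hne⟩ : ∃ h ∈ S, embed x (l - h) ≠ embed x (L + 1 - h) := by
    by_contra! hmatch
    exact hlS (mem_filter.2 ⟨hl, hmatch⟩)
  rw [← mul_prod_erase S _ hh]
  exact (mul_le_of_le_one_right (headScore_nonneg θ x h hl) (prod_headScore_le_one θ x _ hl)).trans
    ((headScore_le_one_sub_attnProb_sq θ x (hSM hh) hl hne).trans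
      (one_sub_attnProb_sq_le_delta2 θ hSM hh))

theorem le_score_of_mem_matchSet (hS : S ∈ lowDeg H D) (hSM : S ⊆ Icc 1 M) {l : ℕ}
    (hl : l ∈ matchSet M S x) :
    1 - (delta1 H D S θ + delta2 M S θ) ≤ score M H D θ x l := by
  have hlIcc : l ∈ Icc (M + 1) L := (mem_filter.1 hl).1
  rw [score_eq_sum]
  calc 1 - (delta1 H D S θ + delta2 M S θ)
      ≤ (1 - delta1 H D S θ) * (1 - delta2 M S θ) := by
        nlinarith [mul_nonneg (delta1_nonneg θ hS) (delta2_nonneg θ hSM)]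
    _ = pRatio H D θ S * (1 - delta2 M S θ) := by rw [delta1, sub_sub_cancel]
    _ ≤ pRatio H D θ S * ∏ h ∈ S, headScore M θ x h l :=
      mul_le_mul_of_nonneg_left (one_sub_delta2_le_prod_headScore θ x hSM hl)
        (pRatio_nonneg H D θ S)
    _ ≤ ∑ T ∈ lowDeg H D, pRatio H D θ T * ∏ h ∈ T, headScore M θ x h l :=
      single_le_sum (f := fun T => pRatio H D θ T * ∏ h ∈ T, headScore M θ x h l)
        (fun T _ => mul_nonneg (pRatio_nonneg H D θ T) (prod_headScore_nonneg θ x T hlIcc)) hS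

theorem score_le_of_notMem_matchSet (hS : S ∈ lowDeg H D) (hSM : S ⊆ Icc 1 M) {l : ℕ}
    (hl : l ∈ Icc (M + 1) L) (hlS : l ∉ matchSet M S x) :
    score M H D θ x l ≤ delta1 H D S θ + delta2 M S θ := by
  have hp1 : pRatio H D θ S ≤ 1 := sub_nonneg.1 (delta1_nonneg θ hS)
  have hrest : ∑ T ∈ (lowDeg H D).erase S, pRatio H D θ T ≤ delta1 H D S θ := by
    rw [delta1, le_sub_iff_add_le, sum_erase_add _ _ hS]
    exact sum_pRatio_le_one H D θ
  rw [score_eq_sum, ← sum_erase_add _ _ hS]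
  refine add_le_add (le_trans (sum_le_sum fun T _ => ?_) hrest) ?_
  · exact mul_le_of_le_one_right (pRatio_nonneg H D θ T) (prod_headScore_le_one θ x T hl)
  · exact (mul_le_of_le_one_left (prod_headScore_nonneg θ x S hl) hp1).trans
      (prod_headScore_le_delta2 θ x hSM hl hlS)

end Score

/-! ### Averages and weighted averages -/

section Averages

variable {ι : Type*} {I A : Finset ι}

theorem sum_abs_sub_eq_two_mul_sum_posPart {u p : ι → ℝ} (h : ∑ i ∈ I, u i = ∑ i ∈ I, p i) :
    ∑ i ∈ I, |u i - p i| = 2 * ∑ i ∈ I, (p i - u i)⁺ := by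
  have habs (i : ι) : |u i - p i| = 2 * (p i - u i)⁺ + (u i - p i) := by
    rw [abs_sub_comm, two_mul, ← two_nsmul, ← abs_add_eq_two_nsmul_posPart]
    ring
  simp only [habs, sum_add_distrib, sum_sub_distrib, h, sub_self, add_zero, mul_sum]

theorem sum_ite_mem_eq_card_mul [DecidableEq ι] (hAI : A ⊆ I) (c : ℝ) :
    ∑ i ∈ I, (if i ∈ A then c else 0) = #A * c := by
  rw [sum_ite_mem, inter_eq_right.2 hAI, sum_const, nsmul_eq_mul]

theorem sum_posPart_sub_uniform_le [DecidableEq ι] (hAI : A ⊆ I) (hA : A.Nonempty) {p : ι → ℝ}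
    {b c : ℝ} (hb : (#A : ℝ)⁻¹ ≤ b) (hc : 0 ≤ c) (hpb : ∀ i ∈ A, p i ≤ b)
    (hpc : ∀ i ∈ I, i ∉ A → p i ≤ c) :
    ∑ i ∈ I, (p i - if i ∈ A then (#A : ℝ)⁻¹ else 0)⁺ ≤ #I * c + (#A * b - 1) := by
  have hcard : (#A : ℝ) ≠ 0 := Nat.cast_ne_zero.2 hA.card_pos.ne'
  calc ∑ i ∈ I, (p i - if i ∈ A then (#A : ℝ)⁻¹ else 0)⁺
      ≤ ∑ i ∈ I, (c + if i ∈ A then b - (#A : ℝ)⁻¹ else 0) := sum_le_sum fun i hi => by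
        split_ifs with hiA
        · exact sup_le (by linarith [hpb i hiA]) (by linarith)
        · exact sup_le (by linarith [hpc i hi hiA]) (by linarith)
    _ = #I * c + (#A * b - 1) := by
        rw [sum_add_distrib, sum_const, nsmul_eq_mul, sum_ite_mem_eq_card_mul hAI, mul_sub,
          mul_inv_cancel₀ hcard]

variable {E : Type*} [NormedAddCommGroup E] [NormedSpace ℝ E] {e : ι → E}

theorem norm_sum_smul_sub_sum_smul_le (he : ∀ i ∈ I, ‖e i‖ ≤ 1) (u p : ι → ℝ) :
    ‖∑ i ∈ I, u i • e i - ∑ i ∈ I, p i • e i‖ ≤ ∑ i ∈ I, |u i - p i| := by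
  rw [← sum_sub_distrib]
  refine norm_sum_le_of_le I fun i hi => ?_
  rw [← sub_smul, norm_smul, Real.norm_eq_abs]
  exact mul_le_of_le_one_right (abs_nonneg _) (he i hi)

/-- Since the uniform weights on `A` and the normalized weights have the same total, only the
excess of the latter over the former has to be bounded. -/
theorem norm_average_sub_weighted_average_le (hAI : A ⊆ I) (hA : A.Nonempty)
    (he : ∀ i ∈ I, ‖e i‖ ≤ 1) {w : ι → ℝ} (hw : ∀ i ∈ I, 0 ≤ w i) {α β κ : ℝ} (hα : 0 < α)
    (hκ : 0 ≤ κ) (hwα : ∀ i ∈ A, α ≤ w i) (hwβ : ∀ i ∈ A, w i ≤ β)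
    (hwκ : ∀ i ∈ I, i ∉ A → w i ≤ κ) :
    ‖(#A : ℝ)⁻¹ • ∑ i ∈ A, e i - ∑ i ∈ I, (w i / ∑ k ∈ I, w k) • e i‖ ≤
      2 * (#I * κ / (#A * α) + (β / α - 1)) := by
  classical
  set W := ∑ k ∈ I, w k
  have hcard : (0 : ℝ) < #A := Nat.cast_pos.2 hA.card_pos
  have hcα : 0 < #A * α := mul_pos hcard hα
  have hαβ : α ≤ β := hA.elim fun i hi => (hwα i hi).trans (hwβ i hi)
  have hW : #A * α ≤ W := by
    rw [← nsmul_eq_mul]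
    exact (card_nsmul_le_sum A w α hwα).trans
      (sum_le_sum_of_subset_of_nonneg hAI fun i hi _ => hw i hi)
  have huniform : ∑ i ∈ I, (if i ∈ A then (#A : ℝ)⁻¹ else 0) = ∑ i ∈ I, w i / W := by
    rw [sum_ite_mem_eq_card_mul hAI, mul_inv_cancel₀ hcard.ne', ← sum_div,
      div_self (hcα.trans_le hW).ne']
  have hexcess : ∑ i ∈ I, (w i / W - if i ∈ A then (#A : ℝ)⁻¹ else 0)⁺ ≤
      #I * (κ / (#A * α)) + (#A * (β / (#A * α)) - 1) :=
    sum_posPart_sub_uniform_le hAI hA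
      (by rw [inv_eq_one_div, div_le_div_iff₀ hcard hcα]; nlinarith) (by positivity)
      (fun i hi => div_le_div₀ (hα.le.trans hαβ) (hwβ i hi) hcα hW)
      (fun i hi hiA => div_le_div₀ hκ (hwκ i hi hiA) hcα hW)
  have haverage : (#A : ℝ)⁻¹ • ∑ i ∈ A, e i =
      ∑ i ∈ I, (if i ∈ A then (#A : ℝ)⁻¹ else 0) • e i := by
    simp only [ite_smul, zero_smul, sum_ite_mem, inter_eq_right.2 hAI, smul_sum]
  rw [haverage]
  refine (norm_sum_smul_sub_sum_smul_le he _ _).trans ?_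
  rw [sum_abs_sub_eq_two_mul_sum_posPart huniform]
  refine mul_le_mul_of_nonneg_left (hexcess.trans_eq ?_) two_pos.le
  field_simp

end Averages

section L1Norm

variable {d L M H D : ℕ} {S : Finset ℕ} (θ : Params) (x : Fin L → Fin d)

theorem l1norm_eq_norm (v : Fin d → ℝ) : l1norm v = ‖WithLp.toLp 1 v‖ := by
  simp [l1norm, PiLp.norm_eq_of_L1]

theorem norm_toLp_embed_le_one (l : ℕ) : ‖WithLp.toLp 1 (embed x l)‖ ≤ 1 := by
  rw [← l1norm_eq_norm, l1norm]
  simp only [abs_of_nonneg (embed_nonneg x l _)]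
  unfold embed
  split_ifs <;> simp

theorem l1norm_gih_sub_tf_le (hS : S ∈ lowDeg H D) (hSM : S ⊆ Icc 1 M) (ha : 0 ≤ θ.a)
    (hmatch : (matchSet M S x).Nonempty) :
    l1norm (gih M S x - tf M H D θ x) ≤
      2 * (L / #(matchSet M S x) *
        exp (-(θ.a * (1 - 2 * (delta1 H D S θ + delta2 M S θ)))) +
          (exp (θ.a * (delta1 H D S θ + delta2 M S θ)) - 1)) := by
  set δ := delta1 H D S θ + delta2 M S θ
  have hsub : matchSet M S x ⊆ Icc (M + 1) L := filter_subset _ _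
  have hexp {s t : ℝ} (h : s ≤ t) : exp (θ.a * s) ≤ exp (θ.a * t) :=
    Real.exp_le_exp.2 (mul_le_mul_of_nonneg_left h ha)
  have havg := norm_average_sub_weighted_average_le hsub hmatch
    (fun l _ => norm_toLp_embed_le_one x l) (fun l _ => (exp_pos (θ.a * score M H D θ x l)).le)
    (exp_pos (θ.a * (1 - δ))) (exp_pos (θ.a * δ)).le
    (fun l hl => hexp (le_score_of_mem_matchSet θ x hS hSM hl))
    (fun l hl => hexp (score_le_one θ x (hsub hl)))
    (fun l hl hlS => hexp (score_le_of_notMem_matchSet θ x hS hSM hl hlS))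
  have hcard : (#(Icc (M + 1) L) : ℝ) ≤ L := by
    rw [Nat.card_Icc, Nat.add_sub_add_right]
    exact Nat.cast_le.2 (Nat.sub_le _ _)
  have hoff : exp (θ.a * δ) / exp (θ.a * (1 - δ)) = exp (-(θ.a * (1 - 2 * δ))) := by
    rw [← Real.exp_sub]; congr 1; ring
  have hspread : exp (θ.a * 1) / exp (θ.a * (1 - δ)) = exp (θ.a * δ) := by
    rw [← Real.exp_sub]; congr 1; ring
  rw [mul_div_mul_comm, hoff, hspread] at havg
  have hgih : gih M S x = (#(matchSet M S x) : ℝ)⁻¹ • ∑ l ∈ matchSet M S x, embed x l :=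
    if_pos hmatch.card_pos
  rw [l1norm_eq_norm, hgih]
  simp only [WithLp.toLp_sub, WithLp.toLp_smul, WithLp.toLp_sum, tf]
  refine havg.trans ?_
  gcongr

end L1Norm

/-! ### Frequency of the matches -/

section Matches

variable {d L M : ℕ} [NeZero d]

theorem embed_eq_single_extendTok (x : Fin L → Fin d) {l : ℕ} (h : 1 ≤ l ∧ l ≤ L) :
    embed x l = Pi.single (extendTok x (l - 1)) 1 := by
  rw [embed_eq_single x h, extendTok_of_lt]

theorem blockCount_le_card_matchSet {B r : ℕ} {S : Finset ℕ} (hM : 0 < M) (hS : S ⊆ Icc 1 M)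
    (x : Fin L → Fin d) (hL : r + B * M < L) :
    blockCount r B (fun j : Fin M => extendTok x (L - M + j)) (extendTok x) ≤
      #(matchSet M S x) := by
  classical
  refine card_le_card_of_injOn (fun k => r + k * M + M + 1) (fun k hk => ?_) fun k _ k' _ h => ?_
  · obtain ⟨hkB, hblock⟩ := mem_filter.1 hk
    have hkM : k * M + M ≤ B * M := by
      rw [← Nat.succ_mul]
      exact Nat.mul_le_mul_right M (mem_range.1 hkB)
    refine mem_filter.2 ⟨mem_Icc.2 ⟨by lia, by lia⟩, fun s hs => ?_⟩
    have hsM := mem_Icc.1 (hS hs)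
    have hj := hblock ⟨M - s, by lia⟩
    rw [embed_eq_single_extendTok x (by lia), embed_eq_single_extendTok x (by lia)]
    convert! congrArg (fun e => (Pi.single e 1 : Fin d → ℝ)) hj using 3 <;> lia
  · exact Nat.eq_of_mul_eq_mul_right hM (by simpa using h)

variable {n : ℕ} {pa : Parents n} {π : TransKernel d n} {ν : (Fin pa.order → Fin d) → ℝ}

theorem one_sub_exp_le_seqPr_forall_le_card_matchSet
    (hν : ν ∈ stdSimplex ℝ (Fin pa.order → Fin d)) {γ : ℝ} (hγ : 0 ≤ γ)
    (hπ : ∀ p x, γ ≤ (π p).1 x) (hM : 0 < M) (hL : 2 * (pa.order + M) ≤ L) :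
    1 - (d : ℝ) ^ M * exp (-(γ ^ M / (8 * M) * L)) ≤ seqPr pa π ν L fun x =>
      ∀ S ⊆ Icc 1 M, γ ^ M / (8 * M) * L ≤ #(matchSet M S x) := by
  set B := (L - 1 - pa.order) / M
  have hdiv : M * B + (L - 1 - pa.order) % M = L - 1 - pa.order := Nat.div_add_mod _ _
  have hmod : (L - 1 - pa.order) % M < M := Nat.mod_lt _ hM
  have hblocks : pa.order + B * M < L := by rw [mul_comm B]; lia
  have hLB : (L : ℝ) ≤ 2 * (M * B) := by exact_mod_cast (by lia : L ≤ 2 * (M * B))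
  have hfreq : γ ^ M / (8 * M) * L ≤ γ ^ M * B / 4 := by
    calc γ ^ M / (8 * M) * L ≤ γ ^ M / (8 * M) * (2 * (M * B)) := by gcongr
      _ = γ ^ M * B / 4 := by field_simp; ring
  calc 1 - (d : ℝ) ^ M * exp (-(γ ^ M / (8 * M) * L))
      ≤ 1 - (d : ℝ) ^ M * exp (-(γ ^ M * B / 4)) := by gcongr
    _ ≤ _ := one_sub_le_seqPr_forall_le_blockCount hν hγ hπ hblocks.le
    _ ≤ _ := seqPr_mono hν.1 fun x hx S hS => hfreq.trans ((hx _).trans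
        (Nat.cast_le.2 (blockCount_le_card_matchSet hM hS x hblocks)))

theorem exp_neg_le_inv {u : ℝ} (hu : 0 < u) : exp (-u) ≤ u⁻¹ := by
  rw [Real.exp_neg]
  exact inv_anti₀ hu (by linarith [Real.add_one_le_exp u])

theorem one_sub_div_le_seqPr_forall_le_card_matchSet
    (hν : ν ∈ stdSimplex ℝ (Fin pa.order → Fin d)) {γ : ℝ} (hγ : 0 < γ)
    (hπ : ∀ p x, γ ≤ (π p).1 x) (hM : 0 < M) (hL : 0 < L) :
    1 - (d ^ M * (8 * M / γ ^ M) + 2 * (pa.order + M)) / L ≤ seqPr pa π ν L fun x =>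
      ∀ S ⊆ Icc 1 M, γ ^ M / (8 * M) * L ≤ #(matchSet M S x) := by
  have hL0 : (0 : ℝ) < L := Nat.cast_pos.2 hL
  have _ : (0 : ℝ) < M := Nat.cast_pos.2 hM
  rcases le_total (2 * (pa.order + M)) L with hlarge | hsmall
  · refine le_trans (sub_le_sub_left ?_ 1)
      (one_sub_exp_le_seqPr_forall_le_card_matchSet hν hγ.le hπ hM hlarge)
    calc (d : ℝ) ^ M * exp (-(γ ^ M / (8 * M) * L))
        ≤ (d : ℝ) ^ M * (γ ^ M / (8 * M) * L)⁻¹ := by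
          gcongr
          exact exp_neg_le_inv (by positivity)
      _ = d ^ M * (8 * M / γ ^ M) / L := by field_simp
      _ ≤ (d ^ M * (8 * M / γ ^ M) + 2 * (pa.order + M)) / L := by
          gcongr
          exact le_add_of_nonneg_right (by positivity)
  · refine le_trans (sub_nonpos.2 ((one_le_div hL0).2 ?_)) (seqPr_nonneg hν.1 _)
    have hsmall' : (L : ℝ) ≤ 2 * (pa.order + M) := by exact_mod_cast hsmall
    exact hsmall'.trans (le_add_of_nonneg_left (by positivity))

end Matches

/-! ### The approximation error -/

theorem rpow_neg_div_log {y : ℝ} (hy : 1 < y) (a : ℝ) :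
    y ^ (-(a / Real.log y)) = exp (-a) := by
  have hlog : Real.log y ≠ 0 := (Real.log_pos hy).ne'
  rw [Real.rpow_def_of_pos (zero_lt_one.trans hy), mul_neg, mul_div_cancel₀ _ hlog]

theorem log_div_le_inv_mul_exp_neg {y a c : ℝ} (hy : 0 < y) (hc : c < 1)
    (ha : a ≤ c * Real.log y) : Real.log y / y ≤ (1 - c)⁻¹ * exp (-a) := by
  have hc1 : 0 < 1 - c := sub_pos.2 hc
  calc Real.log y / y ≤ y ^ (1 - c) / (1 - c) / y := by
        gcongr
        exact Real.log_le_rpow_div hy.le hc1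
    _ = (1 - c)⁻¹ * exp (-(c * Real.log y)) := by
        rw [Real.rpow_sub hy, Real.rpow_one, Real.rpow_def_of_pos hy, Real.exp_neg, mul_comm c]
        field_simp
    _ ≤ (1 - c)⁻¹ * exp (-a) := by gcongr

theorem exp_sub_one_le_mul_exp (u : ℝ) : exp u - 1 ≤ u * exp u := by
  have h := mul_le_mul_of_nonneg_right (one_sub_le_exp_neg u) (exp_pos u).le
  rw [← exp_add, neg_add_cancel, Real.exp_zero] at h
  linarith

theorem l1norm_gih_sub_tf_le_exp_add_log {d L M H D : ℕ} {S : Finset ℕ} (θ : Params)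
    (x : Fin L → Fin d) (hL : 0 < L) (hS : S ∈ lowDeg H D) (hSM : S ⊆ Icc 1 M) (ha : 0 ≤ θ.a)
    {f κ : ℝ} (hf : 0 < f) (hκ : 0 ≤ κ) (hmatch : f * L ≤ #(matchSet M S x))
    (hδ : θ.a * (delta1 H D S θ + delta2 M S θ) ≤ κ * (Real.log L / L)) :
    l1norm (gih M S x - tf M H D θ x) ≤
      2 * f⁻¹ * exp (2 * κ) * exp (-θ.a) + 2 * κ * exp κ * (Real.log L / L) := by
  set δ := delta1 H D S θ + delta2 M S θ
  have hL0 : (0 : ℝ) < L := Nat.cast_pos.2 hL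
  have hcard : (0 : ℝ) < #(matchSet M S x) := (mul_pos hf hL0).trans_le hmatch
  have hlog : Real.log L / L ≤ 1 := (div_le_one hL0).2 (Real.log_le_self hL0.le)
  have hδκ : θ.a * δ ≤ κ := hδ.trans (mul_le_of_le_one_right hκ hlog)
  have hfreq : L / #(matchSet M S x) ≤ f⁻¹ := by
    rwa [div_le_iff₀ hcard, inv_mul_eq_div, le_div_iff₀' hf]
  have hoff : exp (-(θ.a * (1 - 2 * δ))) ≤ exp (2 * κ) * exp (-θ.a) := by
    rw [← exp_add]
    exact Real.exp_le_exp.2 (by linarith)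
  have hspread : exp (θ.a * δ) - 1 ≤ κ * (Real.log L / L) * exp κ :=
    (exp_sub_one_le_mul_exp _).trans (by gcongr)
  calc l1norm (gih M S x - tf M H D θ x)
      ≤ 2 * (L / #(matchSet M S x) * exp (-(θ.a * (1 - 2 * δ))) + (exp (θ.a * δ) - 1)) :=
        l1norm_gih_sub_tf_le θ x hS hSM ha (card_pos.1 (Nat.cast_pos.1 hcard))
    _ ≤ 2 * (f⁻¹ * (exp (2 * κ) * exp (-θ.a)) + κ * (Real.log L / L) * exp κ) := by gcongr
    _ = 2 * f⁻¹ * exp (2 * κ) * exp (-θ.a) + 2 * κ * exp κ * (Real.log L / L) := by ring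

theorem exists_l1norm_gih_sub_tf_le_rpow {f : ℝ} (hf : 0 < f) (K c : ℝ) :
    ∃ C : ℝ, 0 ≤ C ∧ ∀ {d L M H D : ℕ} {S : Finset ℕ} (θ : Params) (x : Fin L → Fin d),
      1 < L → S ∈ lowDeg H D → S ⊆ Icc 1 M → delta1 H D S θ ≤ K / L → delta2 M S θ ≤ K / L →
      0 ≤ θ.a → θ.a ≤ c * Real.log L → f * L ≤ #(matchSet M S x) →
        l1norm (gih M S x - tf M H D θ x) ≤
          C * ((L : ℝ) ^ (-(θ.a / Real.log L)) + Real.log L / L) ∧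
        (c < 1 → l1norm (gih M S x - tf M H D θ x) ≤ C * (L : ℝ) ^ (-(θ.a / Real.log L))) := by
  set κ := |2 * c * K|
  set C₁ := 2 * f⁻¹ * exp (2 * κ)
  set C₂ := 2 * κ * exp κ
  have hC₁ : 0 ≤ C₁ := by positivity
  have hC₂ : 0 ≤ C₂ := by positivity
  refine ⟨C₁ + C₂ + C₂ * |(1 - c)⁻¹|, by positivity, fun {d L M H D S} θ x hL hS hSM h₁ h₂ ha ha'
    hmatch => ?_⟩
  have hL0 : (0 : ℝ) < L := by positivity
  have hlog : 0 ≤ Real.log L / L := div_nonneg (Real.log_natCast_nonneg L) hL0.le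
  have hδ : θ.a * (delta1 H D S θ + delta2 M S θ) ≤ κ * (Real.log L / L) :=
    calc θ.a * (delta1 H D S θ + delta2 M S θ)
        ≤ c * Real.log L * (K / L + K / L) := mul_le_mul ha' (add_le_add h₁ h₂)
          (add_nonneg (delta1_nonneg θ hS) (delta2_nonneg θ hSM)) (ha.trans ha')
      _ = 2 * c * K * (Real.log L / L) := by ring
      _ ≤ κ * (Real.log L / L) := mul_le_mul_of_nonneg_right (le_abs_self _) hlog
  have herror := l1norm_gih_sub_tf_le_exp_add_log θ x (zero_lt_one.trans hL) hS hSM ha hf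
    (abs_nonneg _) hmatch hδ
  rw [rpow_neg_div_log (Nat.one_lt_cast.2 hL)]
  have hexp := (exp_pos (-θ.a)).le
  have hC₃ : 0 ≤ C₂ * |(1 - c)⁻¹| := by positivity
  refine ⟨herror.trans ?_, fun hc => herror.trans ?_⟩
  · nlinarith
  · have hlog_le : Real.log L / L ≤ |(1 - c)⁻¹| * exp (-θ.a) :=
      (log_div_le_inv_mul_exp_neg hL0 hc ha').trans (by gcongr; exact le_abs_self _)
    nlinarith [mul_le_mul_of_nonneg_left hlog_le hC₂]

section Training

variable {Θ : ℝ → Params} {t₁ t₂ t₃ : ℝ} {S : Finset ℕ}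

theorem IsThreeStage.delta1_eq (hΘ : IsThreeStage Θ t₁ t₂ t₃) (H D : ℕ) :
    delta1 H D S (Θ t₃) = delta1 H D S (Θ t₁) := by
  simp only [delta1, pRatio, (hΘ.stage3 t₃ ⟨hΘ.t₂_le, le_rfl⟩).1,
    (hΘ.stage2 t₂ ⟨hΘ.t₁_le, le_rfl⟩).1]

theorem IsThreeStage.delta2_eq (hΘ : IsThreeStage Θ t₁ t₂ t₃) (M : ℕ) :
    delta2 M S (Θ t₃) = delta2 M S (Θ t₂) := by
  simp only [delta2, attnProb, (hΘ.stage3 t₃ ⟨hΘ.t₂_le, le_rfl⟩).2]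

end Training

end NGram

open NGram Finset in
theorem mainTheorem2_general {d n : ℕ} (pa : Parents n) {M : ℕ} (hM : 0 < M) {γ : ℝ} (hγ : 0 < γ)
    (K c : ℝ) :
    ∃ C : ℝ, ∀ π : TransKernel d n, (∀ p x, γ ≤ (π p).1 x) →
      ∀ μ₀ ∈ stdSimplex ℝ (Fin pa.order → Fin d), ∀ L : ℕ, M < L →
      1 - C / L ≤ seqPr pa π μ₀ L fun x => ∀ H D, ∀ S ∈ lowDeg H D, S ⊆ Icc 1 M → ∀ θ,
        delta1 H D S θ ≤ K / L → delta2 M S θ ≤ K / L → 0 ≤ θ.a → θ.a ≤ c * Real.log L →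
          l1norm (gih M S x - tf M H D θ x) ≤
            C * ((L : ℝ) ^ (-(θ.a / Real.log L)) + Real.log L / L) ∧
          (c < 1 →
            l1norm (gih M S x - tf M H D θ x) ≤ C * (L : ℝ) ^ (-(θ.a / Real.log L))) := by
  obtain ⟨C, hC, herror⟩ := exists_l1norm_gih_sub_tf_le_rpow
    (f := γ ^ M / (8 * M)) (by positivity) K c
  set P : ℝ := d ^ M * (8 * M / γ ^ M) + 2 * (pa.order + M)
  have hP : 0 ≤ P := by positivity
  refine ⟨C + P, fun π hπ μ₀ hμ₀ L hL => ?_⟩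
  have _ := neZero_of_mem_stdSimplex hμ₀
  have hL0 : 0 < L := hM.trans hL
  have _ : 0 ≤ Real.log L / L := div_nonneg (Real.log_natCast_nonneg L) L.cast_nonneg
  calc 1 - (C + P) / L ≤ 1 - P / L := by gcongr; exact le_add_of_nonneg_left hC
    _ ≤ _ := one_sub_div_le_seqPr_forall_le_card_matchSet hμ₀ hγ hπ hM hL0
    _ ≤ _ := seqPr_mono hμ₀.1 fun x hx H D S hS hSM θ h₁ h₂ ha ha' => by
      obtain ⟨hle, hle'⟩ := herror θ x (by lia) hS hSM h₁ h₂ ha ha' (hx S hSM)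
      have hCP : C ≤ C + P := le_add_of_nonneg_right hP
      exact ⟨hle.trans (by gcongr), fun hc => (hle' hc).trans (by gcongr)⟩

theorem mainTheorem2 {d n : ℕ} (pa : NGram.Parents n) (M D : ℕ) (hM : pa.order < M)
    (lam γ : ℝ) (hlam : lam < 1) (hγ : 0 < γ)
    (K c₁ c₂ : ℝ) (hc₁ : 0 < c₁) :
    ∃ C : ℝ, ∀ (Pm : MeasureTheory.Measure (NGram.TransKernel d n)),
      MeasureTheory.IsProbabilityMeasure Pm → NGram.MarkovAssumption pa Pm lam γ →
      ∀ μ₀ ∈ stdSimplex ℝ (Fin pa.order → Fin d),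
      ∀ S : Finset ℕ, NGram.IsInfoSet pa M D Pm S →
      ∀ (L : ℕ), M < L →
      ∀ (Θ : ℝ → NGram.Params) (t₁ t₂ t₃ : ℝ), NGram.IsThreeStage Θ t₁ t₂ t₃ →
        NGram.delta1 M D S (Θ t₁) ≤ K / L →
        NGram.delta2 M S (Θ t₂) ≤ K / L →
        c₁ * Real.log L ≤ (Θ t₃).a → (Θ t₃).a ≤ c₂ * Real.log L →
      ∀ π ∈ Pm.support,
        1 - C / L ≤ NGram.seqPr pa π μ₀ L (fun x =>
          NGram.l1norm (NGram.gih M S x - NGram.tf M M D (Θ t₃) x) ≤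
            C * ((L : ℝ) ^ (-((Θ t₃).a / Real.log L)) + Real.log L / L)) ∧
        (c₂ < 1 →
          1 - C / L ≤ NGram.seqPr pa π μ₀ L (fun x =>
            NGram.l1norm (NGram.gih M S x - NGram.tf M M D (Θ t₃) x) ≤
              C * (L : ℝ) ^ (-((Θ t₃).a / Real.log L)))) := by
  obtain ⟨C, hC⟩ := mainTheorem2_general (d := d) pa (pa.order_pos.trans hM) hγ K c₂
  refine ⟨C, fun Pm _ hPm μ₀ hμ₀ S hS L hL Θ t₁ t₂ t₃ hΘ h₁ h₂ ha ha' π hπ => ?_⟩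
  have ha₀ : 0 ≤ (Θ t₃).a := (mul_nonneg hc₁.le (Real.log_natCast_nonneg L)).trans ha
  have hSM : S ⊆ Finset.Icc 1 M := Finset.mem_powerset.1 (Finset.mem_filter.1 hS.1).1
  rw [← hΘ.delta1_eq] at h₁
  rw [← hΘ.delta2_eq] at h₂
  have hprob := hC π (hPm π hπ).2.2 μ₀ hμ₀ L hL
  exact ⟨hprob.trans (NGram.seqPr_mono hμ₀.1 fun x hx =>
      (hx M D S hS.1 hSM _ h₁ h₂ ha₀ ha').1),
    fun hc => hprob.trans (NGram.seqPr_mono hμ₀.1 fun x hx =>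
      (hx M D S hS.1 hSM _ h₁ h₂ ha₀ ha').2 hc)⟩
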